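/- Let $(X,d)$ be a separable metric space with its Borel $\sigma$-algebra (for example $\mathbb R^n$ with the Euclidean distance), and let $P_r,P_g$ be Borel probability measures on $X$, with (closed topological) supports $\operatorname{supp}P_r$ and $\operatorname{supp}P_g$. Let $\Pi(P_r,P_g)$ be the set of probability measures on $X\times X$ with first marginal $P_r$ and second marginal $P_g$, and put $$W_1(P_r,P_g)=\inf_{\pi\in\Pi(P_r,P_g)}\mathbb E_{(x,y)\sim\pi}[d(x,y)]\in[0,\infty],$$ $$I(P_r,P_g)=\sup\{\mathbb E_{x\sim P_r}[f(x)]-\mathbb E_{x\sim P_g}[f(x)] \;:\; f(x)-f(y)\le d(x,y)\ \text{for all } x,y\in X\},$$ $$J(P_r,P_g)=\sup\{\mathbb E_{x\sim P_r}[f(x)]-\mathbb E_{x\sim P_g}[f(x)] \;:\; f(x)-f(y)\le d(x,y)\ \text{for all } x\in\operatorname{supp}P_r,\ y\in\operatorname{supp}P_g\},$$ where in $I$ and $J$ the supremum, taken in $[-\infty,\infty]$, is over functions $f:X\to\mathbb R$ that are integrable with respect to both $P_r$ and $P_g$ and satisfy the stated constraint. Then $$I(P_r,P_g)=J(P_r,P_g)=W_1(P_r,P_g),$$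 where the common value may be $+\infty$. -/

import Mathlib

open MeasureTheory

noncomputable section

/-- `couplings P Q` is the collection `Π(P, Q)` of all probability measures on `X × X` with
marginals `P` and `Q` on the first and second factors. -/
def couplings {X : Type*} [MeasurableSpace X] (P Q : Measure X) : Set (Measure (X × X)) :=
  {π | IsProbabilityMeasure π ∧ π.map Prod.fst = P ∧ π.map Prod.snd = Q}

/-- The primal Wasserstein distance
`W₁(P, Q) = inf_{π ∈ Π(P, Q)} E_{(x, y) ∼ π} [d(x, y)]`, with values in `[0, ∞]`. -/
def wassersteinOne {X : Type*} [MetricSpace X] [MeasurableSpace X] (P Q : Measure X) : ENNReal :=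
  ⨅ π ∈ couplings P Q, ∫⁻ z, edist z.1 z.2 ∂π

/-- `dualValue F P Q = sup_{f ∈ F} (E_{x ∼ P} [f(x)] - E_{x ∼ Q} [f(x)])`, an extended real. The
supremum runs over those `f ∈ F` for which both expectations exist, that is, which are integrable
with respect to both `P` and `Q`. -/
def dualValue {X : Type*} [MeasurableSpace X] (F : Set (X → ℝ)) (P Q : Measure X) : EReal :=
  ⨆ f ∈ {f : X → ℝ | f ∈ F ∧ Integrable f P ∧ Integrable f Q},
    (((∫ x, f x ∂P) - ∫ x, f x ∂Q : ℝ) : EReal)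

/-- The usual dual value `I(P, Q)`: the constraint is `f(x) - f(y) ≤ d(x, y)` for all `x`, `y`. -/
def lipschitzDual {X : Type*} [MetricSpace X] [MeasurableSpace X] (P Q : Measure X) : EReal :=
  dualValue {f : X → ℝ | ∀ x y : X, f x - f y ≤ dist x y} P Q

/-- The compact dual value `J(P, Q)`: the constraint `f(x) - f(y) ≤ d(x, y)` is imposed only for
`x` in the support of `P` and `y` in the support of `Q`. -/
def compactDual {X : Type*} [MetricSpace X] [MeasurableSpace X] (P Q : Measure X) : EReal :=
  dualValue {f : X → ℝ | ∀ x ∈ P.support, ∀ y ∈ Q.support, f x - f y ≤ dist x y} P Q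

end

/-! The proof closes the cycle `I ≤ J ≤ W₁ ≤ I`. The first inequality is inclusion of constraint
sets. For the second, a coupling is concentrated on `supp P × supp Q`, so the constraint on `f`
holds almost everywhere for it.

The third needs a coupling of cost close to `S`, a bound for the dual functional on bounded
1-Lipschitz functions. Cut `X` into countably many cells of radius `ε` and keep finitely many, with
the cost capped at `M`. Finite duality (`exists_finite_coupling_of_dual_le`) yields a discrete plan,
since finite potentials extend to a bounded Lipschitz function on `X`
(`exists_lipschitz_of_potentials`). As the truncation and the cap are removed, the plans converge
along a subsequence to a plan on `ℕ × ℕ` (`exists_limit_coupling`). It is spread over the cells by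
`exists_coupling_of_countable_partition`, and then `ε → 0`. Discretizing in this way avoids
tightness, so completeness of `X` is not needed. -/

/-! ### Finite Kantorovich duality by convex separation. -/

theorem exists_finite_coupling_of_dual_le {ι : Type*} [Fintype ι] {p q : ι → ℝ}
    (hp : ∀ i, 0 ≤ p i) (hq : ∀ i, 0 ≤ q i) (hp1 : ∑ i, p i = 1) (hq1 : ∑ i, q i = 1)
    (c : ι → ι → ℝ) {V : ℝ}
    (hV : ∀ f g : ι → ℝ, (∀ i j, f i + g j ≤ c i j) →
      ∑ i, f i * p i + ∑ j, g j * q j ≤ V) :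
    ∃ π : ι × ι → ℝ, (∀ z, 0 ≤ π z) ∧ (∀ i, ∑ j, π (i, j) = p i) ∧
      (∀ j, ∑ i, π (i, j) = q j) ∧ ∑ z, c z.1 z.2 * π z ≤ V := by
  classical
  by_contra hcon
  let A : (ι × ι → ℝ) → (ι → ℝ) × (ι → ℝ) × ℝ := fun π =>
    (fun i => ∑ j, π (i, j), fun j => ∑ i, π (i, j), ∑ z, c z.1 z.2 * π z)
  have hA : IsLinearMap ℝ A := by
    constructor
    · intro x y
      simp only [A, Pi.add_apply, Finset.sum_add_distrib, mul_add]
      rfl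
    · intro r x
      simp only [A, Pi.smul_apply, smul_eq_mul, ← Finset.mul_sum, mul_left_comm _ r]
      rfl
  have hAc : Continuous A := by fun_prop
  have hKc : IsCompact (A '' stdSimplex ℝ (ι × ι)) := (isCompact_stdSimplex ℝ _).image hAc
  have hKv : Convex ℝ (A '' stdSimplex ℝ (ι × ι)) := (convex_stdSimplex ℝ _).is_linear_image hA
  let R : Set ((ι → ℝ) × (ι → ℝ) × ℝ) := {p} ×ˢ {q} ×ˢ Set.Iic V
  have hdisj : Disjoint (A '' stdSimplex ℝ (ι × ι)) R := by
    rw [Set.disjoint_left]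
    rintro _ ⟨π, hπ, rfl⟩ ⟨h1, h2, h3⟩
    exact hcon ⟨π, hπ.1, fun i => congrFun h1 i, fun j => congrFun h2 j, h3⟩
  obtain ⟨φ, u, v, h1, huv, h2⟩ := geometric_hahn_banach_compact_closed hKv hKc
    ((convex_singleton p).prod ((convex_singleton q).prod (convex_Iic V)))
    (isClosed_singleton.prod (isClosed_singleton.prod isClosed_Iic)) hdisj
  let α : ι → ℝ := fun i => φ (Pi.single i 1, 0, 0)
  let β : ι → ℝ := fun i => φ (0, Pi.single i 1, 0)
  let γ : ℝ := φ (0, 0, 1)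
  have hφ : ∀ a b t, φ (a, b, t) = ∑ i, α i * a i + ∑ j, β j * b j + γ * t := by
    intro a b t
    have : (a, b, t) = ∑ i, a i • ((Pi.single i 1, 0, 0) : (ι → ℝ) × (ι → ℝ) × ℝ)
        + ∑ j, b j • ((0, Pi.single j 1, 0) : (ι → ℝ) × (ι → ℝ) × ℝ)
        + t • ((0, 0, 1) : (ι → ℝ) × (ι → ℝ) × ℝ) := by
      refine Prod.ext ?_ (Prod.ext ?_ ?_)
      · simp [Prod.fst_sum, ← Pi.single_smul, Finset.univ_sum_single]
      · simp [Prod.snd_sum, Prod.fst_sum, ← Pi.single_smul, Finset.univ_sum_single]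
      · simp [Prod.snd_sum]
    rw [this]
    simp only [map_add, map_sum, map_smul, smul_eq_mul, α, β, γ]
    simp only [mul_comm]
  have hprod : (fun z : ι × ι => p z.1 * q z.2) ∈ stdSimplex ℝ (ι × ι) := by
    refine ⟨fun z => mul_nonneg (hp _) (hq _), ?_⟩
    rw [Fintype.sum_prod_type]
    simp [← Finset.mul_sum, hq1, hp1]
  have hVm := h2 (p, q, V) ⟨rfl, rfl, le_refl V⟩
  -- The product plan has the right marginals, so by assumption it costs more than `V`; comparing it
  -- with `(p, q, V)` under `φ` fixes the sign of `γ`.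
  have hγ : γ < 0 := by
    have e1 := h1 _ ⟨_, hprod, rfl⟩
    have ht : V < ∑ z : ι × ι, c z.1 z.2 * (p z.1 * q z.2) := by
      by_contra hle
      refine hcon ⟨_, hprod.1, fun i => ?_, fun j => ?_, not_lt.1 hle⟩
      · simp [← Finset.mul_sum, hq1]
      · simp [← Finset.sum_mul, hp1]
    have : A (fun z : ι × ι => p z.1 * q z.2) =
        (p, q, ∑ z : ι × ι, c z.1 z.2 * (p z.1 * q z.2)) := by
      simp only [A, ← Finset.mul_sum, ← Finset.sum_mul, hq1, hp1, mul_one, one_mul]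
    rw [this, hφ] at e1
    rw [hφ] at hVm
    by_contra hg
    nlinarith [mul_le_mul_of_nonneg_left ht.le (not_lt.1 hg)]
  have hpt : ∀ i j, α i + β j + γ * c i j < u := by
    intro i j
    have hs : (Pi.single (i, j) 1 : ι × ι → ℝ) ∈ stdSimplex ℝ (ι × ι) := single_mem_stdSimplex ℝ _
    have := h1 _ ⟨_, hs, rfl⟩
    have e : A (Pi.single (i, j) 1) = (Pi.single i 1, Pi.single j 1, c i j) := by
      refine Prod.ext ?_ (Prod.ext ?_ ?_)
      · funext k
        by_cases hk : k = i <;> simp [A, Pi.single_apply, Prod.ext_iff, hk]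
      · funext k
        by_cases hk : k = j <;> simp [A, Pi.single_apply, Prod.ext_iff, hk]
      · simp [A, Pi.single_apply]
    rw [e, hφ] at this
    simpa [Pi.single_apply] using this
  -- Dividing the separating functional by `-γ` gives admissible potentials; their dual value
  -- exceeds `V` because `φ (p, q, V) > u`.
  have := hV (fun i => (α i - u) / (-γ)) (fun j => β j / (-γ)) (fun i j => by
    rw [← add_div, div_le_iff₀ (by linarith)]
    linarith [hpt i j])
  have e : ∑ i, (α i - u) / (-γ) * p i + ∑ j, β j / (-γ) * q j =
      (∑ i, α i * p i + ∑ j, β j * q j - u) / (-γ) := by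
    simp only [div_mul_eq_mul_div, ← Finset.sum_div, sub_mul, Finset.sum_sub_distrib,
      ← Finset.mul_sum, hp1]
    ring
  rw [e, div_le_iff₀ (by linarith)] at this
  rw [hφ] at hVm
  linarith

/-! ### Limits of discrete plans. -/

-- Entries converge along a subsequence by compactness of a product of intervals. No mass escapes:
-- along a row the entries are dominated by the summable `β`, along a column by `α`. Bounding only
-- finite partial costs lets the cost pass to the limit entrywise.
open Filter Topology in
theorem exists_limit_coupling {p q α β : ℕ → ℝ} (hα : Summable α) (hβ : Summable β)
    {a b : ℕ → ℕ → ℝ} (hap : ∀ i, Tendsto (fun n => a n i) atTop (𝓝 (p i)))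
    (hbq : ∀ i, Tendsto (fun n => b n i) atTop (𝓝 (q i)))
    (haα : ∀ n i, a n i ≤ α i) (hbβ : ∀ n i, b n i ≤ β i)
    {π : ℕ → ℕ × ℕ → ℝ} (hπ : ∀ n z, 0 ≤ π n z)
    (hrow : ∀ n i, HasSum (fun j => π n (i, j)) (a n i))
    (hcol : ∀ n j, HasSum (fun i => π n (i, j)) (b n j))
    {c : ℕ → ℕ × ℕ → ℝ} {c' : ℕ × ℕ → ℝ} (hc : ∀ z, Tendsto (fun n => c n z) atTop (𝓝 (c' z)))
    {V : ℕ → ℝ} {V' : ℝ} (hV : Tendsto V atTop (𝓝 V'))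
    (hcost : ∀ n (F : Finset (ℕ × ℕ)), ∑ z ∈ F, c n z * π n z ≤ V n) :
    ∃ ρ : ℕ × ℕ → ℝ, (∀ z, 0 ≤ ρ z) ∧ (∀ i, HasSum (fun j => ρ (i, j)) (p i)) ∧
      (∀ j, HasSum (fun i => ρ (i, j)) (q j)) ∧
      ∀ F : Finset (ℕ × ℕ), ∑ z ∈ F, c' z * ρ z ≤ V' := by
  have hπα : ∀ n i j, π n (i, j) ≤ α i := fun n i j =>
    (le_hasSum (hrow n i) j fun k _ => hπ n (i, k)).trans (haα n i)
  have hπβ : ∀ n i j, π n (i, j) ≤ β j := fun n i j =>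
    (le_hasSum (hcol n j) i fun k _ => hπ n (k, j)).trans (hbβ n j)
  have hK : IsCompact (Set.univ.pi fun z : ℕ × ℕ => Set.Icc (0 : ℝ) (α z.1)) :=
    isCompact_univ_pi fun _ => isCompact_Icc
  obtain ⟨ρ, hρ, φ, hφ, hlim⟩ := hK.tendsto_subseq (x := π)
    fun n z _ => ⟨hπ n z, hπα n z.1 z.2⟩
  rw [tendsto_pi_nhds] at hlim
  have hρ0 : ∀ z, 0 ≤ ρ z := fun z => (hρ z trivial).1
  refine ⟨ρ, hρ0, fun i => ?_, fun j => ?_, fun F => ?_⟩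
  · have hs : Summable fun j => ρ (i, j) := by
      refine Summable.of_nonneg_of_le (fun j => hρ0 _) (fun j => ?_) hβ
      exact le_of_tendsto (hlim (i, j)) (Eventually.of_forall fun n => hπβ _ i j)
    have := tendsto_tsum_of_dominated_convergence (𝓕 := atTop)
      (f := fun n j => π (φ n) (i, j)) (g := fun j => ρ (i, j)) hβ (fun j => hlim (i, j))
      (Eventually.of_forall fun n j => by
        rw [Real.norm_of_nonneg (hπ _ _)]; exact hπβ _ i j)
    simp only [(hrow _ _).tsum_eq] at this
    rw [tendsto_nhds_unique ((hap i).comp hφ.tendsto_atTop) this]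
    exact hs.hasSum
  · have hs : Summable fun i => ρ (i, j) := by
      refine Summable.of_nonneg_of_le (fun i => hρ0 _) (fun i => ?_) hα
      exact le_of_tendsto (hlim (i, j)) (Eventually.of_forall fun n => hπα _ i j)
    have := tendsto_tsum_of_dominated_convergence (𝓕 := atTop)
      (f := fun n i => π (φ n) (i, j)) (g := fun i => ρ (i, j)) hα (fun i => hlim (i, j))
      (Eventually.of_forall fun n i => by
        rw [Real.norm_of_nonneg (hπ _ _)]; exact hπα _ i j)
    simp only [(hcol _ _).tsum_eq] at this
    rw [tendsto_nhds_unique ((hbq j).comp hφ.tendsto_atTop) this]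
    exact hs.hasSum
  · refine le_of_tendsto_of_tendsto'
      (tendsto_finsetSum F fun z _ => ((hc z).comp hφ.tendsto_atTop).mul (hlim z))
      (hV.comp hφ.tendsto_atTop) fun n => hcost (φ n) F

/-! ### Countable partitions and gluing. -/

theorem exists_measurable_dist_le {X : Type*} [MetricSpace X] [TopologicalSpace.SeparableSpace X]
    [MeasurableSpace X] [BorelSpace X] [Nonempty X] {ε : ℝ} (hε : 0 < ε) :
    ∃ (x : ℕ → X) (T : X → ℕ), Measurable T ∧ ∀ y, dist y (x (T y)) ≤ ε := by
  classical
  have h : ∀ y : X, ∃ n, dist y (TopologicalSpace.denseSeq X n) < ε := fun y => by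
    obtain ⟨n, hn⟩ :=
      (TopologicalSpace.denseRange_denseSeq X).exists_dist_lt y hε
    exact ⟨n, hn⟩
  refine ⟨TopologicalSpace.denseSeq X, fun y => Nat.find (h y), ?_, fun y => (Nat.find_spec (h y)).le⟩
  exact measurable_find h fun n => measurableSet_ball (x := TopologicalSpace.denseSeq X n)

-- The coupling is `∑ w (i, j) • (κ i × ν j)`, with `κ i` and `ν j` the conditional laws of `P` and
-- `Q` on the cells.
open ProbabilityTheory in
theorem exists_coupling_of_countable_partition {X : Type*} [MeasurableSpace X] {P Q : Measure X}
    [IsProbabilityMeasure P] [IsProbabilityMeasure Q] {T : X → ℕ} (hT : Measurable T)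
    {w : ℕ × ℕ → ENNReal} (hrow : ∀ i, ∑' j, w (i, j) = P (T ⁻¹' {i}))
    (hcol : ∀ j, ∑' i, w (i, j) = Q (T ⁻¹' {j})) {c : X × X → ENNReal}
    {C : ℕ × ℕ → ENNReal} (hcC : ∀ y z, c (y, z) ≤ C (T y, T z)) :
    ∃ π ∈ couplings P Q, ∫⁻ z, c z ∂π ≤ ∑' z, w z * C z := by
  have hm : ∀ i, MeasurableSet (T ⁻¹' {i}) := fun i => hT (measurableSet_singleton i)
  let κ : ℕ → Measure X := fun i => P[|T ⁻¹' {i}]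
  let ν : ℕ → Measure X := fun i => Q[|T ⁻¹' {i}]
  have hκ : ∀ i, IsZeroOrProbabilityMeasure (κ i) := fun i => by dsimp only [κ]; infer_instance
  have hν : ∀ i, IsZeroOrProbabilityMeasure (ν i) := fun i => by dsimp only [ν]; infer_instance
  -- On a null cell the conditional measure is zero rather than a probability, but then the weights
  -- of that row vanish too.
  have hwκ : ∀ i j, w (i, j) * κ i Set.univ = w (i, j) := by
    intro i j
    by_cases h : P (T ⁻¹' {i}) = 0
    · rw [(ENNReal.tsum_eq_zero.1 ((hrow i).trans h)) j, zero_mul]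
    · have : IsProbabilityMeasure (κ i) := cond_isProbabilityMeasure h
      rw [measure_univ, mul_one]
  have hwν : ∀ i j, w (i, j) * ν j Set.univ = w (i, j) := by
    intro i j
    by_cases h : Q (T ⁻¹' {j}) = 0
    · rw [(ENNReal.tsum_eq_zero.1 ((hcol j).trans h)) i, zero_mul]
    · have : IsProbabilityMeasure (ν j) := cond_isProbabilityMeasure h
      rw [measure_univ, mul_one]
  have hdec : ∀ (R : Measure X) [IsProbabilityMeasure R] (s : Set X), MeasurableSet s →
      ∑' i, R (T ⁻¹' {i}) * R[|T ⁻¹' {i}] s = R s := by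
    intro R _ s hs
    have : ∀ i, R (T ⁻¹' {i}) * R[|T ⁻¹' {i}] s = R (T ⁻¹' {i} ∩ s) := fun i => by
      rw [mul_comm, cond_mul_eq_inter (hm i)]
    simp only [this]
    rw [← measure_iUnion]
    · congr 1
      ext y
      simp
    · intro i j hij
      refine Set.disjoint_left.2 fun y hy hy' => hij ?_
      exact hy.1.symm.trans hy'.1
    · exact fun i => (hm i).inter hs
  let π : Measure (X × X) := Measure.sum fun z : ℕ × ℕ => w z • (κ z.1).prod (ν z.2)
  have h1 : π.map Prod.fst = P := by
    ext s hs
    rw [Measure.map_apply measurable_fst hs, Measure.sum_apply _ (measurable_fst hs),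
      ENNReal.tsum_prod', ← hdec P s hs]
    refine tsum_congr fun i => ?_
    rw [← hrow, ← ENNReal.tsum_mul_right]
    refine tsum_congr fun j => ?_
    rw [Measure.smul_apply, ← Set.prod_univ, Measure.prod_prod, smul_eq_mul, mul_comm (κ i s),
      ← mul_assoc, hwν]
  have h2 : π.map Prod.snd = Q := by
    ext s hs
    rw [Measure.map_apply measurable_snd hs, Measure.sum_apply _ (measurable_snd hs),
      ENNReal.tsum_prod', ENNReal.tsum_comm, ← hdec Q s hs]
    refine tsum_congr fun j => ?_
    rw [← hcol, ← ENNReal.tsum_mul_right]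
    refine tsum_congr fun i => ?_
    rw [Measure.smul_apply, ← Set.univ_prod, Measure.prod_prod, smul_eq_mul, ← mul_assoc, hwκ]
  refine ⟨π, ⟨⟨?_⟩, h1, h2⟩, ?_⟩
  · rw [← Set.preimage_univ (f := Prod.fst), ← Measure.map_apply measurable_fst .univ, h1,
      measure_univ]
  · rw [lintegral_sum_measure]
    refine ENNReal.tsum_le_tsum fun z => ?_
    rw [lintegral_smul_measure, smul_eq_mul]
    gcongr
    have e1 : ∀ᵐ y ∂(κ z.1).prod (ν z.2), T y.1 = z.1 :=
      Measure.quasiMeasurePreserving_fst.ae (ae_cond_mem (hm z.1))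
    have e2 : ∀ᵐ y ∂(κ z.1).prod (ν z.2), T y.2 = z.2 :=
      Measure.quasiMeasurePreserving_snd.ae (ae_cond_mem (hm z.2))
    calc ∫⁻ y, c y ∂(κ z.1).prod (ν z.2) ≤ ∫⁻ _, C z ∂(κ z.1).prod (ν z.2) := by
          refine lintegral_mono_ae ?_
          filter_upwards [e1, e2] with y h1 h2
          refine (hcC y.1 y.2).trans ?_
          rw [h1, h2]
      _ = C z * (κ z.1).prod (ν z.2) Set.univ := lintegral_const _
      _ ≤ C z := mul_le_of_le_one_right' (by
          rw [← Set.univ_prod_univ, Measure.prod_prod]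
          exact mul_le_one' prob_le_one prob_le_one)

/-! ### Truncation to finitely many cells. -/

/-- The retraction of `ℕ` onto `{0, …, N}` that sends every larger number to `0`. -/
def truncIndex (N k : ℕ) : Fin (N + 1) := if h : k < N + 1 then ⟨k, h⟩ else 0

theorem val_truncIndex_of_le {N k : ℕ} (h : k ≤ N) : (truncIndex N k : ℕ) = k := by
  simp [truncIndex, Nat.lt_succ_of_le h]

theorem val_truncIndex_of_lt {N k : ℕ} (h : N < k) : (truncIndex N k : ℕ) = 0 := by
  simp [truncIndex, not_lt.2 (Nat.succ_le_of_lt h)]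

/-- Only index `0` can gain mass, and at most `1`. The second bound is thus independent of `N` and
summable in `i`, as `exists_limit_coupling` requires. -/
theorem measureReal_truncIndex_bounds {X : Type*} [MeasurableSpace X] (P : Measure X)
    [IsProbabilityMeasure P] (T : X → ℕ) (N i : ℕ) :
    |P.real {y | (truncIndex N (T y) : ℕ) = i} - P.real (T ⁻¹' {i})| ≤ P.real {y | N < T y} ∧
      P.real {y | (truncIndex N (T y) : ℕ) = i} ≤
        P.real (T ⁻¹' {i}) + (Pi.single 0 1 : ℕ → ℝ) i := by
  constructor
  · have h1 : P.real {y | (truncIndex N (T y) : ℕ) = i} ≤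
        P.real (T ⁻¹' {i}) + P.real {y | N < T y} := by
      refine (measureReal_mono fun y hy => ?_).trans (measureReal_union_le _ _)
      by_cases h : N < T y
      · exact Or.inr h
      · exact Or.inl ((val_truncIndex_of_le (not_lt.1 h)).symm.trans hy)
    have h2 : P.real (T ⁻¹' {i}) ≤
        P.real {y | (truncIndex N (T y) : ℕ) = i} + P.real {y | N < T y} := by
      refine (measureReal_mono fun y hy => ?_).trans (measureReal_union_le _ _)
      by_cases h : N < T y
      · exact Or.inr h
      · exact Or.inl ((val_truncIndex_of_le (not_lt.1 h)).trans hy)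
    rw [abs_le]
    constructor <;> linarith
  · by_cases hi : i = 0
    · subst hi
      rw [Pi.single_eq_same]
      exact measureReal_le_one.trans (le_add_of_nonneg_left measureReal_nonneg)
    · rw [Pi.single_eq_of_ne hi, add_zero]
      refine measureReal_mono fun y hy => ?_
      rcases le_or_gt (T y) N with h | h
      · exact (val_truncIndex_of_le h).symm.trans hy
      · exact absurd ((val_truncIndex_of_lt h).symm.trans hy).symm hi

theorem exists_measureReal_tail_le {X : Type*} [MeasurableSpace X] (P : Measure X)
    [IsProbabilityMeasure P] {T : X → ℕ} (hT : Measurable T) {δ : ℝ} (hδ : 0 < δ) :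
    ∀ᶠ N in Filter.atTop, P.real {y | N < T y} ≤ δ := by
  have h := tendsto_measure_iInter_atTop (μ := P) (s := fun N : ℕ => {y | N < T y})
    (fun N => (measurableSet_lt measurable_const hT).nullMeasurableSet)
    (fun N M hNM y hy => lt_of_le_of_lt hNM hy) ⟨0, measure_ne_top _ _⟩
  have e : ⋂ N : ℕ, {y | N < T y} = ∅ := by
    ext y
    simpa using ⟨T y, le_rfl⟩
  rw [e, measure_empty] at h
  have h' := (ENNReal.tendsto_toReal ENNReal.zero_ne_top).comp h
  exact (h'.eventually (gt_mem_nhds (by simpa using hδ))).mono fun N hN => hN.le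

theorem integral_comp_fintype {X ι : Type*} [MeasurableSpace X] [Fintype ι] [MeasurableSpace ι]
    [MeasurableSingletonClass ι] (P : Measure X) [IsProbabilityMeasure P] {τ : X → ι}
    (hτ : Measurable τ) (f : ι → ℝ) :
    Integrable (fun y => f (τ y)) P ∧ ∫ y, f (τ y) ∂P = ∑ i, f i * P.real (τ ⁻¹' {i}) := by
  have hp : IsProbabilityMeasure (P.map τ) := Measure.isProbabilityMeasure_map hτ.aemeasurable
  have hf : Integrable f (P.map τ) := Integrable.of_finite
  refine ⟨hf.comp_measurable hτ, ?_⟩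
  rw [← integral_map hτ.aemeasurable hf.aestronglyMeasurable, integral_fintype hf]
  refine Finset.sum_congr rfl fun i _ => ?_
  rw [map_measureReal_apply hτ (measurableSet_singleton i), smul_eq_mul, mul_comm]

/-! ### From Lipschitz bounds to truncated plans. -/

/-- The value `S` bounds the dual functional on all bounded `1`-Lipschitz functions. -/
def BoundsLipschitzDual {X : Type*} [MetricSpace X] [MeasurableSpace X] (P Q : Measure X)
    (S : ℝ) : Prop :=
  ∀ F : X → ℝ, (∀ x y, F x - F y ≤ dist x y) → (∃ C, ∀ x, |F x| ≤ C) →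
    ∫ x, F x ∂P - ∫ x, F x ∂Q ≤ S

/-- `F` is the transform of `g` for the capped distance. The cap preserves the triangle inequality
and bounds the oscillation of `F` by `M`. -/
theorem exists_lipschitz_of_potentials {X ι : Type*} [MetricSpace X] [Nonempty X] [Fintype ι]
    [Nonempty ι] (x : ι → X) {M : ℝ} (hM : 0 ≤ M) (f g : ι → ℝ)
    (hfg : ∀ i j, f i + g j ≤ min (dist (x i) (x j)) M) :
    ∃ F : X → ℝ, (∀ y z, F y - F z ≤ min (dist y z) M) ∧ (∀ i, f i ≤ F (x i)) ∧
      (∀ j, g j ≤ -F (x j)) ∧ ∃ C, ∀ y, |F y| ≤ C := by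
  let F : X → ℝ := fun y =>
    Finset.univ.inf' Finset.univ_nonempty fun j => min (dist y (x j)) M - g j
  have hF : ∀ y z, F y - F z ≤ min (dist y z) M := by
    intro y z
    obtain ⟨j, -, hj⟩ := Finset.exists_mem_eq_inf' (Finset.univ_nonempty (α := ι))
      fun j => min (dist z (x j)) M - g j
    have h1 : F y ≤ min (dist y (x j)) M - g j := Finset.inf'_le _ (Finset.mem_univ j)
    have h2 : F z = min (dist z (x j)) M - g j := hj
    have h3 : min (dist y (x j)) M ≤ min (dist y z) M + min (dist z (x j)) M := by
      have := dist_triangle y z (x j)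
      have := dist_nonneg (x := y) (y := z)
      have := dist_nonneg (x := z) (y := x j)
      rcases min_cases (dist y z) M with h | h <;> rcases min_cases (dist z (x j)) M with h' | h' <;>
        rcases min_cases (dist y (x j)) M with h'' | h'' <;> linarith
    linarith
  refine ⟨F, hF, fun i => ?_, fun j => ?_, ?_⟩
  · refine Finset.le_inf' _ _ fun j _ => ?_
    linarith [hfg i j]
  · have : F (x j) ≤ min (dist (x j) (x j)) M - g j := Finset.inf'_le _ (Finset.mem_univ j)
    rw [dist_self, min_eq_left hM] at this
    linarith
  · obtain ⟨z⟩ := ‹Nonempty X›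
    refine ⟨|F z| + M, fun y => ?_⟩
    have h1 := (hF y z).trans (min_le_right _ _)
    have h2 := (hF z y).trans (min_le_right _ _)
    rw [abs_le]
    constructor <;> linarith [le_abs_self (F z), neg_abs_le (F z)]

/-- Replacing a point by its retained centre changes `F` by at most `ε`, or by `M` on the overflow
set of mass at most `δ`. Doing so for both marginals gives the error `2 * ε + 2 * (M * δ)`. -/
theorem exists_truncated_coupling {X : Type*} [MetricSpace X]
    [TopologicalSpace.SeparableSpace X] [MeasurableSpace X] [BorelSpace X] {P Q : Measure X}
    [IsProbabilityMeasure P] [IsProbabilityMeasure Q] {S : ℝ} (hS : BoundsLipschitzDual P Q S)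
    {ε : ℝ} {x : ℕ → X} {T : X → ℕ} (hT : Measurable T)
    (hx : ∀ y, dist y (x (T y)) ≤ ε) {M δ : ℝ} (hM : 0 ≤ M) {N : ℕ}
    (hP : P.real {y | N < T y} ≤ δ) (hQ : Q.real {y | N < T y} ≤ δ) :
    ∃ π : ℕ × ℕ → ℝ, (∀ z, 0 ≤ π z) ∧
      (∀ i, HasSum (fun j => π (i, j)) (P.real {y | (truncIndex N (T y) : ℕ) = i})) ∧
      (∀ j, HasSum (fun i => π (i, j)) (Q.real {y | (truncIndex N (T y) : ℕ) = j})) ∧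
      ∀ F : Finset (ℕ × ℕ), ∑ z ∈ F, min (dist (x z.1) (x z.2)) M * π z ≤
        S + 2 * ε + 2 * (M * δ) := by
  classical
  have hne : Nonempty X := P.nonempty_of_neZero
  have hsc : SecondCountableTopology X := UniformSpace.secondCountable_of_separable X
  let τ : X → Fin (N + 1) := fun y => truncIndex N (T y)
  have hτ : Measurable τ := (measurable_of_countable (truncIndex N)).comp hT
  have hsum : ∀ (μ : Measure X) [IsProbabilityMeasure μ], ∑ i, μ.real (τ ⁻¹' {i}) = 1 := by
    intro μ _
    have := (integral_comp_fintype μ hτ fun _ => 1).2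
    simpa using this.symm
  have hdist : ∀ y, min (dist (x (τ y)) y) M ≤ ε + {y | N < T y}.indicator (fun _ => M) y := by
    intro y
    have hε : 0 ≤ ε := dist_nonneg.trans (hx y)
    by_cases h : N < T y
    · rw [Set.indicator_of_mem (by exact h)]
      linarith [min_le_right (dist (x (τ y)) y) M]
    · rw [Set.indicator_of_notMem (by exact h), add_zero]
      refine (min_le_left _ _).trans ?_
      rw [show (τ y : ℕ) = T y from val_truncIndex_of_le (not_lt.1 h), dist_comm]
      exact hx y
  have hms : MeasurableSet {y | N < T y} := measurableSet_lt measurable_const hT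
  have hind : ∀ (μ : Measure X) [IsProbabilityMeasure μ],
      Integrable (fun y => ε + {y | N < T y}.indicator (fun _ => M) y) μ ∧
        ∫ y, (ε + {y | N < T y}.indicator (fun _ => M) y) ∂μ = ε + M * μ.real {y | N < T y} := by
    intro μ _
    have hi : Integrable ({y | N < T y}.indicator (fun _ : X => M)) μ :=
      (integrable_const M).indicator hms
    refine ⟨(integrable_const ε).add hi, ?_⟩
    rw [integral_add (integrable_const ε) hi, integral_indicator_const _ hms]
    simp [mul_comm]
  obtain ⟨π, h0, h1, h2, h3⟩ := exists_finite_coupling_of_dual_le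
    (p := fun i => P.real (τ ⁻¹' {i})) (q := fun i => Q.real (τ ⁻¹' {i}))
    (fun i => measureReal_nonneg) (fun i => measureReal_nonneg) (hsum P) (hsum Q)
    (fun i j => min (dist (x i) (x j)) M) (V := S + 2 * ε + 2 * (M * δ)) (by
      intro f g hfg
      obtain ⟨F, hF, hf, hg, C, hC⟩ :=
        exists_lipschitz_of_potentials (fun i : Fin (N + 1) => x i) hM f g hfg
      have hFc : Continuous F := by
        refine (LipschitzWith.of_le_add fun y z => ?_).continuous
        linarith [(hF y z).trans (min_le_left _ _)]
      have hFi : ∀ (μ : Measure X) [IsProbabilityMeasure μ], Integrable F μ := fun μ _ =>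
        Integrable.of_bound hFc.aestronglyMeasurable C (Filter.Eventually.of_forall hC)
      have hb := hS F (fun y z => (hF y z).trans (min_le_left _ _)) ⟨C, hC⟩
      have e1 : ∫ y, f (τ y) ∂P ≤
          ∫ y, F y ∂P + (ε + M * P.real {y | N < T y}) := by
        rw [← (hind P).2, ← integral_add (hFi P) (hind P).1]
        refine integral_mono (integral_comp_fintype P hτ f).1 ((hFi P).add (hind P).1) fun y => ?_
        have := hF (x (τ y)) y
        linarith [hf (τ y), hdist y]
      have e2 : ∫ y, g (τ y) ∂Q ≤
          -∫ y, F y ∂Q + (ε + M * Q.real {y | N < T y}) := by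
        rw [← (hind Q).2, ← integral_neg, ← integral_add (f := fun y => -F y) (hFi Q).neg (hind Q).1]
        refine integral_mono (integral_comp_fintype Q hτ g).1
          ((hFi Q).neg.add (hind Q).1) fun y => ?_
        have := hF y (x (τ y))
        rw [dist_comm] at this
        linarith [hg (τ y), hdist y]
      rw [← (integral_comp_fintype P hτ f).2, ← (integral_comp_fintype Q hτ g).2]
      have := mul_le_mul_of_nonneg_left hP hM
      have := mul_le_mul_of_nonneg_left hQ hM
      linarith)
  -- The finite plan is extended by zero, so that plans for different `N` share the index set `ℕ ×
  -- ℕ`.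
  let e : Fin (N + 1) × Fin (N + 1) → ℕ × ℕ := fun z => (z.1, z.2)
  have he : Function.Injective e := fun z w h =>
    Prod.ext (Fin.ext (congrArg Prod.fst h)) (Fin.ext (congrArg Prod.snd h))
  have hπe : ∀ i j : Fin (N + 1), Function.extend e π 0 (i, j) = π (i, j) :=
    fun i j => he.extend_apply π 0 (i, j)
  have hout : ∀ i j : ℕ, (N < i ∨ N < j) → Function.extend e π 0 (i, j) = 0 := by
    intro i j hij
    refine Function.extend_apply' _ _ _ ?_
    rintro ⟨z, hz⟩
    have hz1 : (z.1 : ℕ) = i := congrArg Prod.fst hz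
    have hz2 : (z.2 : ℕ) = j := congrArg Prod.snd hz
    omega
  have hempty : ∀ (μ : Measure X) i, N < i → μ.real {y | (truncIndex N (T y) : ℕ) = i} = 0 := by
    intro μ i hi
    have : {y | (truncIndex N (T y) : ℕ) = i} = ∅ := by
      ext y
      simp only [Set.mem_ofPred_eq, Set.mem_empty_iff_false, iff_false]
      omega
    rw [this, measureReal_empty]
  have hfib : ∀ (μ : Measure X) (i : Fin (N + 1)),
      μ.real {y | (truncIndex N (T y) : ℕ) = i} = μ.real (τ ⁻¹' {i}) := by
    intro μ i
    congr 1
    ext y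
    exact Fin.val_inj
  have hpos : ∀ z, 0 ≤ Function.extend e π 0 z := by
    intro z
    by_cases hz : ∃ w, e w = z
    · obtain ⟨w, rfl⟩ := hz
      rw [he.extend_apply]
      exact h0 w
    · rw [Function.extend_apply' _ _ _ hz]
      rfl
  refine ⟨Function.extend e π 0, hpos, fun i => ?_, fun j => ?_, fun F => ?_⟩
  · rcases lt_or_ge N i with hi | hi
    · simp only [hout i _ (Or.inl hi), hempty P i hi]
      exact hasSum_zero
    · lift i to Fin (N + 1) using Nat.lt_succ_of_le hi
      rw [hfib, ← h1, ← Fin.val_injective.hasSum_iff]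
      · rw [show (fun j => Function.extend e π 0 (↑i, j)) ∘ Fin.val = fun j => π (i, j) from
          funext fun j => hπe i j]
        exact hasSum_fintype _
      · intro j hj
        refine hout _ _ (Or.inr (not_le.1 fun hle => hj ⟨⟨j, Nat.lt_succ_of_le hle⟩, rfl⟩))
  · rcases lt_or_ge N j with hj | hj
    · simp only [hout _ j (Or.inr hj), hempty Q j hj]
      exact hasSum_zero
    · lift j to Fin (N + 1) using Nat.lt_succ_of_le hj
      rw [hfib, ← h2, ← Fin.val_injective.hasSum_iff]
      · rw [show (fun i => Function.extend e π 0 (i, ↑j)) ∘ Fin.val = fun i => π (i, j) from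
          funext fun i => hπe i j]
        exact hasSum_fintype _
      · intro i hi
        refine hout _ _ (Or.inl (not_le.1 fun hle => hi ⟨⟨i, Nat.lt_succ_of_le hle⟩, rfl⟩))
  · have hs : HasSum (fun z : ℕ × ℕ => min (dist (x z.1) (x z.2)) M * Function.extend e π 0 z)
        (∑ z : Fin (N + 1) × Fin (N + 1), min (dist (x z.1) (x z.2)) M * π z) := by
      rw [← he.hasSum_iff]
      · simp only [Function.comp_def, he.extend_apply]
        exact hasSum_fintype _
      · intro z hz
        rw [Function.extend_apply' _ _ _ hz]
        simp
    exact (sum_le_hasSum F (fun z _ => mul_nonneg (le_min dist_nonneg hM) (hpos z)) hs).trans h3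

/-! ### The inequality `W₁ ≤ S`. -/

open Filter Topology in
theorem wassersteinOne_le_of_boundsLipschitzDual {X : Type*} [MetricSpace X]
    [TopologicalSpace.SeparableSpace X] [MeasurableSpace X] [BorelSpace X] {P Q : Measure X}
    [IsProbabilityMeasure P] [IsProbabilityMeasure Q] {S : ℝ} (hS0 : 0 ≤ S)
    (hS : BoundsLipschitzDual P Q S) : wassersteinOne P Q ≤ ENNReal.ofReal S := by
  have hne : Nonempty X := P.nonempty_of_neZero
  have key : ∀ ε : ℝ, 0 < ε → wassersteinOne P Q ≤ ENNReal.ofReal (S + 4 * ε) := by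
    intro ε hε
    obtain ⟨x, T, hT, hx⟩ := exists_measurable_dist_le (X := X) hε
    -- The cap at stage `n` is `M = n`, so `δ` must be `o(1/n)` for the error `M * δ` to vanish.
    let δ : ℕ → ℝ := fun n => 1 / ((n : ℝ) + 1) ^ 2
    have hδ0 : ∀ n, 0 < δ n := fun n => by positivity
    have hinv : Tendsto (fun n : ℕ => 1 / ((n : ℝ) + 1)) atTop (𝓝 0) :=
      tendsto_one_div_add_atTop_nhds_zero_nat
    have hδ : Tendsto δ atTop (𝓝 0) := by
      have := hinv.mul hinv
      simp only [mul_zero] at this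
      refine this.congr fun n => ?_
      simp only [δ]
      field_simp
    have hnδ : Tendsto (fun n : ℕ => (n : ℝ) * δ n) atTop (𝓝 0) := by
      refine squeeze_zero (fun n => mul_nonneg n.cast_nonneg (hδ0 n).le) (fun n => ?_) hinv
      have hn : (0 : ℝ) < n + 1 := by positivity
      simp only [δ]
      rw [mul_one_div, div_le_div_iff₀ (by positivity) hn]
      nlinarith
    choose N hNP hNQ using fun n => ((exists_measureReal_tail_le P hT (hδ0 n)).and
      (exists_measureReal_tail_le Q hT (hδ0 n))).exists
    choose π hπ0 hrow hcol hcost using fun n : ℕ =>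
      exists_truncated_coupling hS hT hx n.cast_nonneg (hNP n) (hNQ n)
    have hfib : ∀ (μ : Measure X) [IsProbabilityMeasure μ], ∑' i, μ (T ⁻¹' {i}) = 1 := by
      intro μ _
      rw [← measure_iUnion]
      · rw [← Set.preimage_iUnion, Set.iUnion_of_singleton, Set.preimage_univ, measure_univ]
      · exact fun i j hij => Set.disjoint_left.2 fun y hy hy' => hij (Eq.trans (Eq.symm hy) hy')
      · exact fun i => hT (measurableSet_singleton i)
    have hsummable : ∀ (μ : Measure X) [IsProbabilityMeasure μ],
        Summable fun i => μ.real (T ⁻¹' {i}) + (Pi.single 0 1 : ℕ → ℝ) i := by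
      intro μ _
      exact (ENNReal.summable_toReal (by rw [hfib μ]; exact ENNReal.one_ne_top)).add
        (hasSum_pi_single 0 1).summable
    have hlim : ∀ (μ : Measure X) [IsProbabilityMeasure μ], (∀ n, μ.real {y | N n < T y} ≤ δ n) →
        ∀ i, Tendsto (fun n => μ.real {y | (truncIndex (N n) (T y) : ℕ) = i}) atTop
          (𝓝 (μ.real (T ⁻¹' {i}))) := by
      intro μ _ h i
      rw [tendsto_iff_dist_tendsto_zero]
      refine squeeze_zero (fun _ => dist_nonneg) (fun n => ?_) hδ
      exact (measureReal_truncIndex_bounds μ T (N n) i).1.trans (h n)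
    obtain ⟨ρ, hρ0, hρrow, hρcol, hρcost⟩ := exists_limit_coupling (hsummable P) (hsummable Q)
      (hlim P hNP) (hlim Q hNQ)
      (fun n i => (measureReal_truncIndex_bounds P T (N n) i).2)
      (fun n i => (measureReal_truncIndex_bounds Q T (N n) i).2) hπ0 hrow hcol
      (c := fun n z => min (dist (x z.1) (x z.2)) n) (c' := fun z => dist (x z.1) (x z.2))
      (fun z => by
        refine tendsto_const_nhds.congr' ?_
        filter_upwards [eventually_ge_atTop ⌈dist (x z.1) (x z.2)⌉₊] with n hn
        exact (min_eq_left (Nat.ceil_le.1 hn)).symm)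
      (V' := S + 2 * ε)
      (by simpa using tendsto_const_nhds.add (hnδ.const_mul 2)) hcost
    have hmarg : ∀ {h : ℕ → ℝ} {a : ENNReal}, (∀ k, 0 ≤ h k) → HasSum h a.toReal → a ≠ ⊤ →
        ∑' k, ENNReal.ofReal (h k) = a := by
      intro h a h0 hs ha
      rw [← ENNReal.ofReal_tsum_of_nonneg h0 hs.summable, hs.tsum_eq, ENNReal.ofReal_toReal ha]
    have hW1 : ∀ i, ∑' j, ENNReal.ofReal (ρ (i, j)) = P (T ⁻¹' {i}) := fun i =>
      hmarg (fun j => hρ0 _) (hρrow i) (measure_ne_top _ _)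
    have hW2 : ∀ j, ∑' i, ENNReal.ofReal (ρ (i, j)) = Q (T ⁻¹' {j}) := fun j =>
      hmarg (fun j => hρ0 _) (hρcol j) (measure_ne_top _ _)
    obtain ⟨m, hm, hmc⟩ := exists_coupling_of_countable_partition (P := P) (Q := Q) hT
      (w := fun z => ENNReal.ofReal (ρ z)) hW1 hW2
      (c := fun z => edist z.1 z.2)
      -- Passing from centres back to points costs another `2 * ε`, whence `4 * ε` in total.
      (C := fun z => ENNReal.ofReal (dist (x z.1) (x z.2)) + ENNReal.ofReal (2 * ε))
      (fun y z => by
        rw [edist_dist, ← ENNReal.ofReal_add dist_nonneg (by positivity)]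
        refine ENNReal.ofReal_le_ofReal ?_
        have := dist_triangle4 y (x (T y)) (x (T z)) z
        have := hx y
        have := hx z
        rw [dist_comm] at this
        dsimp only
        linarith)
    have hmass : ∑' z, ENNReal.ofReal (ρ z) = 1 := by
      have h := (ENNReal.tsum_prod' (f := fun z : ℕ × ℕ => ENNReal.ofReal (ρ z)))
      rw [h]
      simp only [hW1]
      exact hfib P
    calc wassersteinOne P Q ≤ ∫⁻ z, edist z.1 z.2 ∂m := iInf₂_le m hm
      _ ≤ _ := hmc
      _ = ∑' z, ENNReal.ofReal (ρ z) * ENNReal.ofReal (dist (x z.1) (x z.2)) +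
          (∑' z, ENNReal.ofReal (ρ z)) * ENNReal.ofReal (2 * ε) := by
        simp only [mul_add, ENNReal.tsum_add, ENNReal.tsum_mul_right]
      _ ≤ ENNReal.ofReal (S + 2 * ε) + 1 * ENNReal.ofReal (2 * ε) := by
        rw [hmass]
        gcongr
        rw [ENNReal.tsum_eq_iSup_sum]
        refine iSup_le fun F => ?_
        simp only [← ENNReal.ofReal_mul (hρ0 _)]
        rw [← ENNReal.ofReal_sum_of_nonneg fun z _ => mul_nonneg (hρ0 z) dist_nonneg]
        refine ENNReal.ofReal_le_ofReal (le_trans (le_of_eq ?_) (hρcost F))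
        exact Finset.sum_congr rfl fun z _ => mul_comm _ _
      _ = ENNReal.ofReal (S + 4 * ε) := by
        rw [one_mul, ← ENNReal.ofReal_add (by positivity) (by positivity)]
        congr 1
        ring
  have hlim : Tendsto (fun ε : ℝ => ENNReal.ofReal (S + 4 * ε)) (𝓝[>] 0) (𝓝 (ENNReal.ofReal S)) := by
    refine ENNReal.tendsto_ofReal ?_
    have : Continuous fun ε : ℝ => S + 4 * ε := by fun_prop
    simpa using (this.tendsto 0).mono_left nhdsWithin_le_nhds
  exact ge_of_tendsto hlim (eventually_mem_nhdsWithin.mono key)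

/-! ### The cycle of inequalities. -/

theorem ofReal_integral_le_lintegral_ofReal {Ω : Type*} [MeasurableSpace Ω] {μ : Measure Ω}
    {f : Ω → ℝ} (hf : Integrable f μ) :
    ENNReal.ofReal (∫ x, f x ∂μ) ≤ ∫⁻ x, ENNReal.ofReal (f x) ∂μ := by
  refine ENNReal.ofReal_le_of_le_toReal ?_
  rw [integral_eq_lintegral_pos_part_sub_lintegral_neg_part hf]
  exact sub_le_self _ ENNReal.toReal_nonneg

theorem compactDual_le_wassersteinOne {X : Type*} [MetricSpace X]
    [TopologicalSpace.SeparableSpace X] [MeasurableSpace X] [BorelSpace X] (P Q : Measure X) :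
    compactDual P Q ≤ (wassersteinOne P Q : EReal) := by
  have hsc : SecondCountableTopology X := UniformSpace.secondCountable_of_separable X
  refine iSup₂_le fun f ⟨hf, hfP, hfQ⟩ => ?_
  suffices h : ENNReal.ofReal (∫ x, f x ∂P - ∫ x, f x ∂Q) ≤ wassersteinOne P Q by
    refine le_trans ?_ (EReal.coe_ennreal_le_coe_ennreal_iff.2 h)
    rw [EReal.coe_ennreal_ofReal]
    exact EReal.coe_le_coe_iff.2 (le_max_left _ _)
  refine le_iInf₂ fun π ⟨hπ, h1, h2⟩ => ?_
  -- Supports have full measure because `X` is second countable.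
  have hP1 : ∀ᵐ z ∂π, z.1 ∈ P.support := by
    refine ae_of_ae_map measurable_fst.aemeasurable ?_
    rw [h1]
    exact P.support_mem_ae
  have hQ2 : ∀ᵐ z ∂π, z.2 ∈ Q.support := by
    refine ae_of_ae_map measurable_snd.aemeasurable ?_
    rw [h2]
    exact Q.support_mem_ae
  subst h1 h2
  have i1 : Integrable (fun z : X × X => f z.1) π := hfP.comp_measurable measurable_fst
  have i2 : Integrable (fun z : X × X => f z.2) π := hfQ.comp_measurable measurable_snd
  rw [integral_map measurable_fst.aemeasurable hfP.aestronglyMeasurable,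
    integral_map measurable_snd.aemeasurable hfQ.aestronglyMeasurable, ← integral_sub i1 i2]
  refine (ofReal_integral_le_lintegral_ofReal (i1.sub i2)).trans (lintegral_mono_ae ?_)
  filter_upwards [hP1, hQ2] with z hz1 hz2
  rw [edist_dist]
  exact ENNReal.ofReal_le_ofReal (hf _ hz1 _ hz2)

theorem lipschitzDual_le_compactDual {X : Type*} [MetricSpace X] [MeasurableSpace X]
    (P Q : Measure X) : lipschitzDual P Q ≤ compactDual P Q :=
  biSup_mono fun _ hf => ⟨fun x _ y _ => hf.1 x y, hf.2⟩

theorem wassersteinOne_le_lipschitzDual {X : Type*} [MetricSpace X]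
    [TopologicalSpace.SeparableSpace X] [MeasurableSpace X] [BorelSpace X] (P Q : Measure X)
    [IsProbabilityMeasure P] [IsProbabilityMeasure Q] :
    (wassersteinOne P Q : EReal) ≤ lipschitzDual P Q := by
  have hsc : SecondCountableTopology X := UniformSpace.secondCountable_of_separable X
  by_cases htop : lipschitzDual P Q = ⊤
  · simp [htop]
  -- Bounded Lipschitz functions are integrable for every probability measure, so they compete in
  -- `I`; `f = 0` gives `0 ≤ I`.
  have hle : ∀ f : X → ℝ, (∀ x y, f x - f y ≤ dist x y) → (∃ C, ∀ x, |f x| ≤ C) →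
      ((∫ x, f x ∂P - ∫ x, f x ∂Q : ℝ) : EReal) ≤ lipschitzDual P Q := by
    rintro f hf ⟨C, hC⟩
    have hc : Continuous f :=
      (LipschitzWith.of_le_add fun y z => by linarith [hf y z]).continuous
    have hi : ∀ (μ : Measure X) [IsProbabilityMeasure μ], Integrable f μ := fun μ _ =>
      Integrable.of_bound hc.aestronglyMeasurable C (Filter.Eventually.of_forall hC)
    exact le_iSup₂_of_le f ⟨hf, hi P, hi Q⟩ le_rfl
  have h0 : (0 : EReal) ≤ lipschitzDual P Q := by
    simpa using hle 0 (fun x y => by simp) ⟨0, by simp⟩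
  have hbot : lipschitzDual P Q ≠ ⊥ := fun h => by simp [h] at h0
  have hS := EReal.coe_toReal htop hbot
  have hS0 : 0 ≤ (lipschitzDual P Q).toReal := EReal.toReal_nonneg h0
  have := wassersteinOne_le_of_boundsLipschitzDual (P := P) (Q := Q) hS0 fun F hF hC => by
    have := hle F hF hC
    rw [← hS] at this
    exact EReal.coe_le_coe_iff.1 this
  rw [← hS, ← max_eq_left hS0, ← EReal.coe_ennreal_ofReal]
  exact EReal.coe_ennreal_le_coe_ennreal_iff.2 this

theorem mainTheorem6 {X : Type*} [MetricSpace X] [TopologicalSpace.SeparableSpace X]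
    [MeasurableSpace X] [BorelSpace X]
    (Pr Pg : Measure X) [IsProbabilityMeasure Pr] [IsProbabilityMeasure Pg] :
    lipschitzDual Pr Pg = compactDual Pr Pg ∧
      compactDual Pr Pg = (wassersteinOne Pr Pg : EReal) := by
  have h1 := lipschitzDual_le_compactDual Pr Pg
  have h2 := compactDual_le_wassersteinOne Pr Pg
  have h3 := wassersteinOne_le_lipschitzDual Pr Pg
  exact ⟨h1.antisymm (h2.trans h3), h2.antisymm (h3.trans h1)⟩
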